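/- Fix a constant $c>0$. We consider directed graphs $G$ on the vertex set $V=\{0,\dots,n-1\}$, $n\ge 1$ (an arc is an ordered pair of vertices), with at most $m$ arcs, where $m\ge cn$. The distance between two directed graphs on $V$ is the number of arcs that lie in exactly one of them, divided by $m$. $G$ is *$\epsilon$-close* to strong connectivity if some strongly connected directed graph on $V$ (one with a directed path from $u$ to $v$ for all $u,v\in V$) is at distance at most $\epsilon$ from $G$, and *$\epsilon$-far* otherwise. A neighbor oracle for $G$ holds, for every vertex, an arbitrarily ordered list of its in-neighbors and one of its out-neighbors; a query asks for the in- or out-degree of a vertex $v$, or for the $i$-th in- or out-neighbor of $v$. For all $\alpha,\beta,\epsilon>0$ there is an $(\epsilon,(4+\alpha)\epsilon+\beta)$-tolerant tester for strong connectivity of directed graphs, i.e. a randomized algorithm that is given $n$, $m$ and access to a neighbor oracle for $G$, such that - it always halts, after at most $q(m)$ queries, for some function $q$ with $q(m)=o(m)$ that depends only on $\alpha,\beta,\epsilon,c$; - if $G$ is $\epsilon$-close to strong connectivity, it accepts with probability at least $\tfrac23$; - if $G$ is $((4+\alpha)\epsilon+\beta)$-far from strong connectivity, it accepts with probability at most $\tfrac13$.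 -/

import Mathlib

open Filter Asymptotics

namespace TolerantTesting

/-! Directed graphs on the vertex set `Fin n`; an arc is an ordered pair of vertices. -/

/-- The set of arcs of a directed graph. -/
def arcs {n : ℕ} (G : Digraph (Fin n)) : Set (Fin n × Fin n) :=
  {p | G.Adj p.1 p.2}

/-- The distance between two directed graphs: the number of arcs that lie in exactly one of them,
divided by the bound `m` on the number of arcs. -/
noncomputable def graphDist {n : ℕ} (m : ℕ) (G H : Digraph (Fin n)) : ℝ :=
  ((symmDiff (arcs G) (arcs H)).ncard : ℝ) / m

/-- A property of directed graphs: for every `n`, a set of graphs on `n` vertices. -/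
abbrev GraphProperty : Type := ∀ n : ℕ, Set (Digraph (Fin n))

/-- `G` is `ε`-close to `P`: the minimum of the distances from `G` to the members of `P`
on the same vertex set is at most `ε`. -/
def IsClose (P : GraphProperty) {n : ℕ} (m : ℕ) (ε : ℝ) (G : Digraph (Fin n)) : Prop :=
  ∃ H ∈ P n, graphDist m G H ≤ ε

/-- `G` is `ε`-far from `P`: it is not `ε`-close to `P`. -/
def IsFar (P : GraphProperty) {n : ℕ} (m : ℕ) (ε : ℝ) (G : Digraph (Fin n)) : Prop :=
  ¬ IsClose P m ε G

/-- Strong connectivity: there is a directed path between every ordered pair of vertices. -/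
def strongConnectivity : GraphProperty :=
  fun _ => {G | ∀ u v, Relation.ReflTransGen G.Adj u v}

/-! The neighbor oracle. -/

/-- A representation of `G` by adjacency lists: for every vertex its in-neighbors and its
out-neighbors, each listed once, in an arbitrary order. -/
structure AdjacencyLists {n : ℕ} (G : Digraph (Fin n)) where
  inList : Fin n → List (Fin n)
  outList : Fin n → List (Fin n)
  inList_nodup : ∀ v, (inList v).Nodup
  outList_nodup : ∀ v, (outList v).Nodup
  mem_inList : ∀ v u, u ∈ inList v ↔ G.Adj u v
  mem_outList : ∀ v u, u ∈ outList v ↔ G.Adj v u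

/-- The queries: the in- or out-degree of the vertex `v`, or the in- or out-neighbor of `v` at
position `i` of the list. Vertices are named by the numbers `0, …, n - 1`. -/
inductive Query : Type
  | inDeg (v : ℕ)
  | outDeg (v : ℕ)
  | inNbr (v i : ℕ)
  | outNbr (v i : ℕ)

/-- The answer to a query. It is `none` if there is no such vertex, or no `i`-th neighbor
(positions are counted from `0`). -/
def AdjacencyLists.answer {n : ℕ} {G : Digraph (Fin n)} (R : AdjacencyLists G) :
    Query → Option ℕ
  | .inDeg v => if hv : v < n then some (R.inList ⟨v, hv⟩).length else none
  | .outDeg v => if hv : v < n then some (R.outList ⟨v, hv⟩).length else none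
  | .inNbr v i => if hv : v < n then ((R.inList ⟨v, hv⟩)[i]?).map Fin.val else none
  | .outNbr v i => if hv : v < n then ((R.outList ⟨v, hv⟩)[i]?).map Fin.val else none

/-! Randomized algorithms with oracle access. -/

/-- What an algorithm does next: halt and accept (`true`) or reject (`false`), draw a uniformly
random element of `{0, …, k}`, or make a query to the oracle. -/
inductive Move : Type
  | halt (accept : Bool)
  | toss (k : ℕ)
  | ask (q : Query)

def Query.equivSum : Query ≃ (ℕ ⊕ ℕ) ⊕ ((ℕ × ℕ) ⊕ (ℕ × ℕ)) where
  toFun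
    | .inDeg v => .inl (.inl v)
    | .outDeg v => .inl (.inr v)
    | .inNbr v i => .inr (.inl (v, i))
    | .outNbr v i => .inr (.inr (v, i))
  invFun
    | .inl (.inl v) => .inDeg v
    | .inl (.inr v) => .outDeg v
    | .inr (.inl (v, i)) => .inNbr v i
    | .inr (.inr (v, i)) => .outNbr v i
  left_inv q := by cases q <;> rfl
  right_inv x := by rcases x with (_ | _) | (_ | _) <;> rfl

instance : Primcodable Query := Primcodable.ofEquiv _ Query.equivSum

def Move.equivSum : Move ≃ Bool ⊕ (ℕ ⊕ Query) where
  toFun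
    | .halt b => .inl b
    | .toss k => .inr (.inl k)
    | .ask q => .inr (.inr q)
  invFun
    | .inl b => .halt b
    | .inr (.inl k) => .toss k
    | .inr (.inr q) => .ask q
  left_inv x := by cases x <;> rfl
  right_inv x := by rcases x with _ | (_ | _) <;> rfl

instance : Primcodable Move := Primcodable.ofEquiv _ Move.equivSum

/-- The history of a run: the random numbers drawn (`some r`) and the answers of the oracle
received so far, oldest first. -/
abbrev History : Type := List (Option ℕ)

/-- A (uniform) randomized algorithm with oracle access: a computable rule that, given the number
`n` of vertices, the bound `m` on the number of arcs and the history of the run, says what to do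
next. -/
structure RandomizedAlgorithm where
  next : ℕ → ℕ → History → Move
  computable : Computable fun x : ℕ × ℕ × History => next x.1 x.2.1 x.2.2

/-- `HaltsWithin A O t q h`: when continued from the history `h` with oracle `O`, the rule `A`
halts, for all outcomes of the random draws, within `t` moves (the move of halting included), of
which at most `q` are queries. -/
def HaltsWithin (A : History → Move) (O : Query → Option ℕ) : ℕ → ℕ → History → Prop
  | 0, _, _ => False
  | t + 1, q, h =>
    match A h with
    | .halt _ => True
    | .toss k => ∀ r ≤ k, HaltsWithin A O t q (h ++ [some r])
    | .ask x => 0 < q ∧ HaltsWithin A O t (q - 1) (h ++ [O x])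

/-- The probability that the rule `A`, continued from the history `h` with oracle `O`, halts and
accepts within `t` moves. -/
noncomputable def acceptProb (A : History → Move) (O : Query → Option ℕ) : ℕ → History → ℝ
  | 0, _ => 0
  | t + 1, h =>
    match A h with
    | .halt b => if b then 1 else 0
    | .toss k => (∑ r ∈ Finset.range (k + 1), acceptProb A O t (h ++ [some r])) / (k + 1)
    | .ask x => acceptProb A O t (h ++ [O x])

/-- `T` is an `(ε₁, ε₂)`-tolerant tester for `P`, for directed graphs with at most `m` arcs, where
`m ≥ c * n` for the number `n` of vertices: it always halts after at most `q m = o(m)` queries,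
accepts every graph that is `ε₁`-close to `P` with probability at least `2/3`, and accepts every
graph that is `ε₂`-far from `P` with probability at most `1/3`. As all runs halt within `t` moves,
`acceptProb … t []` is the probability that `T` accepts. -/
def IsTolerantTester (c : ℝ) (P : GraphProperty) (ε₁ ε₂ : ℝ) (T : RandomizedAlgorithm) : Prop :=
  ∃ q : ℕ → ℕ, (fun m => (q m : ℝ)) =o[atTop] (fun m => (m : ℝ)) ∧
    ∀ n m : ℕ, 0 < n → c * n ≤ m →
      ∀ (G : Digraph (Fin n)) (R : AdjacencyLists G), (arcs G).ncard ≤ m →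
        ∃ t : ℕ, HaltsWithin (T.next n m) R.answer t (q m) [] ∧
          (IsClose P m ε₁ G → 2 / 3 ≤ acceptProb (T.next n m) R.answer t []) ∧
          (IsFar P m ε₂ G → acceptProb (T.next n m) R.answer t [] ≤ 1 / 3)

end TolerantTesting

/-! Call a strong component a source if no arc enters it, a sink if none leaves it, and proper if it
is not the whole graph. In a strongly connected graph every proper source of `G` is entered by an
arc that is missing from `G`, and different sources need different arcs, so the distance times `m`
is at least the number of proper sources, and likewise of proper sinks. Conversely, joining all
sources and sinks through one hub vertex costs at most one arc each. Hence the number of proper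
sources and sinks together determines the distance up to a factor 2; the rest of the factor `4 + α`
is slack.

At most `n / k` sources have more than `k` vertices, and `m ≥ c * n` lets the `β`-term absorb them.
A source with at most `k` vertices has all its in-neighbors inside, hence in-degrees at most `k`, so
a backward exploration of constant size sees it completely and can certify it (`Flag.sound`,
`Flag.complete`). The certified set lies between the small proper sources and all proper sources
(`IsSourceSample`), which is enough for both bounds; choosing least vertices counts each component
once. Sinks are sources of the reversed graph.

The tester estimates the number of certified vertices from `s` random roots in each direction and
compares it with a rational threshold just above `2 * ε`. Chebyshev's inequality
(`abs_acceptProb_sub_le`) bounds the error by `1 / 3`. The number of queries is constant, hence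
`o(m)`. -/

open Relation

/-! ### Source components and the distance to strong connectivity -/

/-- `v` is the least vertex of a source component of the relation `r`. -/
def IsSourceRep {α : Type*} [LE α] (r : α → α → Prop) (v : α) : Prop :=
  (∀ u, ReflTransGen r u v → ReflTransGen r v u) ∧ ∀ u, ReflTransGen r u v → v ≤ u

theorem IsSourceRep.eq_of_common {α : Type*} [PartialOrder α] {r : α → α → Prop} {v w b : α}
    (hv : IsSourceRep r v) (hw : IsSourceRep r w) (hbv : ReflTransGen r b v)
    (hbw : ReflTransGen r b w) : v = w :=
  le_antisymm (hv.2 w ((hw.1 b hbw).trans hbv)) (hw.2 v ((hv.1 b hbv).trans hbw))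

theorem exists_step_into {α : Type*} {r : α → α → Prop} {S : Set α} {w v : α}
    (h : ReflTransGen r w v) (hw : w ∉ S) (hv : v ∈ S) : ∃ a b, r a b ∧ a ∉ S ∧ b ∈ S := by
  induction h with
  | refl => exact absurd hv hw
  | @tail b c _ hbc ih =>
    by_cases hb : b ∈ S
    · exact ih hb
    · exact ⟨b, c, hbc, hb, hv⟩

/-- An `r'`-path from a vertex outside the ancestor set of `v` must enter that set by an arc not in
`r`. The head of this arc is an ancestor of only one representative, so the choice of arc is
injective. -/
theorem ncard_sourceReps_le {α : Type*} [Finite α] [PartialOrder α] {r r' : α → α → Prop}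
    (hr' : ∀ u v, ReflTransGen r' u v) (F : Set α)
    (hF : ∀ v ∈ F, IsSourceRep r v ∧ ∃ w, ¬ ReflTransGen r w v) :
    F.ncard ≤ {p : α × α | r' p.1 p.2 ∧ ¬ r p.1 p.2}.ncard := by
  have key : ∀ v ∈ F, ∃ p : α × α, (r' p.1 p.2 ∧ ¬ r p.1 p.2) ∧ ReflTransGen r p.2 v := by
    intro v hv
    obtain ⟨w, hw⟩ := (hF v hv).2
    obtain ⟨a, b, hab, ha, hb⟩ := exists_step_into (S := {u | ReflTransGen r u v}) (hr' w v) hw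
      ReflTransGen.refl
    exact ⟨(a, b), ⟨hab, fun h => ha (ReflTransGen.head h hb)⟩, hb⟩
  choose! f hf using key
  refine Set.ncard_le_ncard_of_injOn f (fun v hv => (hf v hv).1) ?_ (Set.toFinite _)
  intro v hv w hw hvw
  exact (hF v hv).1.eq_of_common (hF w hw).1 (hf v hv).2 (hvw ▸ (hf w hw).2)

/-- The ancestor sets of distinct representatives are disjoint. -/
theorem ncard_large_sourceReps_mul_le {α : Type*} [Fintype α] [PartialOrder α]
    (r : α → α → Prop) (k : ℕ) :
    {v | IsSourceRep r v ∧ k < {u | ReflTransGen r u v}.ncard}.ncard * k ≤ Fintype.card α := by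
  classical
  set L : Finset α := Finset.univ.filter
    (fun v => IsSourceRep r v ∧ k < {u | ReflTransGen r u v}.ncard) with hL
  set C : α → Finset α := fun v => Finset.univ.filter (fun u => ReflTransGen r u v) with hC
  have hcard : ∀ v, (C v).card = {u | ReflTransGen r u v}.ncard := fun v => by
    rw [Set.ncard_eq_toFinset_card']; congr 1; ext; simp [hC]
  have hset : {v | IsSourceRep r v ∧ k < {u | ReflTransGen r u v}.ncard} = (L : Set α) := by
    ext; simp [hL]
  rw [hset, Set.ncard_coe_finset]
  have hdisj : (L : Set α).PairwiseDisjoint C := by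
    intro v hv w hw hvw
    refine Finset.disjoint_left.2 fun b hb hb' => hvw ?_
    simp only [hL, hC, Finset.coe_filter, Set.mem_ofPred_eq, Finset.mem_filter] at hv hw hb hb'
    exact hv.2.1.eq_of_common hw.2.1 hb.2 hb'.2
  calc L.card * k ≤ ∑ v ∈ L, (C v).card := by
        rw [← smul_eq_mul]
        refine Finset.card_nsmul_le_sum _ _ _ fun v hv => ?_
        rw [hcard]
        exact (Finset.mem_filter.1 hv).2.2.le
    _ = (L.biUnion C).card := (Finset.card_biUnion hdisj).symm
    _ ≤ _ := Finset.card_le_univ _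

/-- An ancestor of `u` with the fewest ancestors lies in a source component. -/
theorem exists_sourceRep_reaching {α : Type*} [Finite α] [LinearOrder α] (r : α → α → Prop)
    (u : α) : ∃ v, IsSourceRep r v ∧ ReflTransGen r v u := by
  obtain ⟨w, hw, hmin⟩ := Set.exists_min_image {w | ReflTransGen r w u}
    (fun w => {x | ReflTransGen r x w}.ncard) (Set.toFinite _) ⟨u, ReflTransGen.refl⟩
  have hsrc : ∀ x, ReflTransGen r x w → ReflTransGen r w x := by
    intro x hx
    have hsub : {y | ReflTransGen r y x} ⊆ {y | ReflTransGen r y w} := fun y hy => hy.trans hx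
    have heq := Set.eq_of_subset_of_ncard_le hsub (hmin x (hx.trans hw)) (Set.toFinite _)
    exact (Set.ext_iff.1 heq w).2 ReflTransGen.refl
  obtain ⟨v, hv, hvmin⟩ := Set.exists_min_image {x | ReflTransGen r x w} id (Set.toFinite _)
    ⟨w, ReflTransGen.refl⟩
  have hvw : ReflTransGen r v w := hv
  exact ⟨v, ⟨fun x hx => hvw.trans (hsrc x (hx.trans hvw)), fun x hx => hvmin x (hx.trans hvw)⟩,
    hvw.trans hw⟩

namespace TolerantTesting

theorem exists_stronglyConnected_near {n : ℕ} (hn : 0 < n) (G : Digraph (Fin n)) :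
    ∃ H ∈ strongConnectivity n, (symmDiff (arcs G) (arcs H)).ncard ≤
      {v | IsSourceRep G.Adj v}.ncard + {v | IsSourceRep (Function.swap G.Adj) v}.ncard := by
  -- The hub: arcs run from every sink representative to `z` and from `z` to every source
  -- representative.
  set z : Fin n := ⟨0, hn⟩
  set A : Set (Fin n × Fin n) := (fun v => (z, v)) '' {v | IsSourceRep G.Adj v} with hA
  set B : Set (Fin n × Fin n) := (fun v => (v, z)) '' {v | IsSourceRep (Function.swap G.Adj) v}
    with hB
  let H : Digraph (Fin n) := ⟨fun a b => G.Adj a b ∨ (a, b) ∈ A ∪ B⟩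
  have hGH : ∀ a b, ReflTransGen G.Adj a b → ReflTransGen H.Adj a b :=
    fun a b h => ReflTransGen.mono (fun _ _ h => Or.inl h) a b h
  refine ⟨H, ?_, ?_⟩
  · intro u v
    obtain ⟨s, hs, hsv⟩ := exists_sourceRep_reaching G.Adj v
    obtain ⟨t, ht, htu⟩ := exists_sourceRep_reaching (Function.swap G.Adj) u
    rw [reflTransGen_swap] at htu
    have h1 : H.Adj t z := Or.inr (Or.inr ⟨t, ht, rfl⟩)
    have h2 : H.Adj z s := Or.inr (Or.inl ⟨s, hs, rfl⟩)
    exact ((hGH _ _ htu).tail h1).trans (ReflTransGen.head h2 (hGH _ _ hsv))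
  · have hsub : symmDiff (arcs G) (arcs H) ⊆ A ∪ B := by
      rintro ⟨a, b⟩ (⟨h1, h2⟩ | ⟨h1, h2⟩)
      · exact absurd (Or.inl h1) h2
      · exact h1.resolve_left h2
    exact (Set.ncard_le_ncard hsub (Set.toFinite _)).trans ((Set.ncard_union_le _ _).trans
      (Nat.add_le_add (Set.ncard_image_le (Set.toFinite _)) (Set.ncard_image_le (Set.toFinite _))))

/-- `F` contains only least vertices of proper source components of `r`, and all those
of components with at most `k` vertices. -/
structure IsSourceSample {n : ℕ} (r : Fin n → Fin n → Prop) (k : ℕ) (F : Set (Fin n)) : Prop where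
  sound : ∀ v ∈ F, IsSourceRep r v ∧ ∃ w, ¬ ReflTransGen r w v
  complete : ∀ v, IsSourceRep r v → (∃ w, ¬ ReflTransGen r w v) →
    {u | ReflTransGen r u v}.ncard ≤ k → v ∈ F

theorem IsSourceSample.ncard_le_of_stronglyConnected {n k : ℕ} {G H : Digraph (Fin n)}
    {F : Set (Fin n)} (hF : IsSourceSample G.Adj k F) (hH : H ∈ strongConnectivity n) :
    F.ncard ≤ (symmDiff (arcs G) (arcs H)).ncard :=
  (ncard_sourceReps_le hH F hF.sound).trans
    (Set.ncard_le_ncard (fun _ hp => Or.inr hp) (Set.toFinite _))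

theorem IsSourceSample.ncard_swap_le_of_stronglyConnected {n k : ℕ} {G H : Digraph (Fin n)}
    {F : Set (Fin n)} (hF : IsSourceSample (Function.swap G.Adj) k F)
    (hH : H ∈ strongConnectivity n) :
    F.ncard ≤ (symmDiff (arcs G) (arcs H)).ncard := by
  refine (ncard_sourceReps_le (r' := Function.swap H.Adj)
    (fun u v => reflTransGen_swap.2 (hH v u)) F hF.sound).trans ?_
  exact Set.ncard_le_ncard_of_injOn Prod.swap (fun _ hp => Or.inr hp)
    Prod.swap_injective.injOn (Set.toFinite _)

theorem IsSourceSample.ncard_sourceReps_mul_le {n k : ℕ} {r : Fin n → Fin n → Prop}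
    {F : Set (Fin n)} (hF : IsSourceSample r k F) (hr : ∃ u v, ¬ ReflTransGen r u v) :
    {v | IsSourceRep r v}.ncard * k ≤ F.ncard * k + n := by
  have hsub : {v | IsSourceRep r v} ⊆
      F ∪ {v | IsSourceRep r v ∧ k < {u | ReflTransGen r u v}.ncard} := by
    intro v hv
    by_cases hk : k < {u | ReflTransGen r u v}.ncard
    · exact Or.inr ⟨hv, hk⟩
    · refine Or.inl (hF.complete v hv ?_ (not_lt.1 hk))
      -- A source reached from every vertex would be the whole graph, against `hr`.
      by_contra! hall
      obtain ⟨a, b, hab⟩ := hr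
      exact hab ((hall a).trans (hv.1 b (hall b)))
  have h1 := (Set.ncard_le_ncard hsub (Set.toFinite _)).trans (Set.ncard_union_le _ _)
  have h2 := ncard_large_sourceReps_mul_le r k
  rw [Fintype.card_fin] at h2
  nlinarith

theorem exists_stronglyConnected_near_of_sample {n k : ℕ} (hn : 0 < n) {G : Digraph (Fin n)}
    {F F' : Set (Fin n)} (hF : IsSourceSample G.Adj k F)
    (hF' : IsSourceSample (Function.swap G.Adj) k F') :
    ∃ H ∈ strongConnectivity n,
      (symmDiff (arcs G) (arcs H)).ncard * k ≤ (F.ncard + F'.ncard) * k + 2 * n := by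
  by_cases hG : G ∈ strongConnectivity n
  · exact ⟨G, hG, by simp⟩
  · obtain ⟨H, hH, hle⟩ := exists_stronglyConnected_near hn G
    have hG' : ∃ u v, ¬ ReflTransGen G.Adj u v := by
      simpa [strongConnectivity] using hG
    have hG'' : ∃ u v, ¬ ReflTransGen (Function.swap G.Adj) u v := by
      obtain ⟨u, v, h⟩ := hG'
      exact ⟨v, u, by rwa [reflTransGen_swap]⟩
    have h1 := hF.ncard_sourceReps_mul_le hG'
    have h2 := hF'.ncard_sourceReps_mul_le hG''
    exact ⟨H, hH, by nlinarith [Nat.mul_le_mul_right k hle]⟩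

end TolerantTesting

/-! ### Bounded exploration trees that certify small source components -/

namespace TolerantTesting

/-- The labels of the `K`-ary tree rooted at `r` whose node `x` has the children
`K * x + i + 1`, `i < K`, labelled by the answers `ans u i`, where `u` is the label of `x`
(`n` stands for a missing label). -/
def label (ans : ℕ → ℕ → Option ℕ) (n K r : ℕ) : ℕ → Option ℕ
  | 0 => some r
  | t + 1 => ans ((label ans n K r (t / K)).getD n) (t % K)
  decreasing_by exact Nat.lt_succ_of_le (Nat.div_le_self _ _)

/-- The parent of a node of the `K`-ary tree. -/
def parent (K t : ℕ) : ℕ := (t - 1) / K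

/-- The test whether the root label is the least vertex of a proper source component, read off
from the labels of the first `N` nodes of the tree: the labels of the first `M` nodes are closed
under predecessors, every one of them is reached from the root label by a path in the tree, and
the root label is the least of them. -/
def Flag (K M N n : ℕ) (e : ℕ → Option ℕ) : Prop :=
  (∀ x < M, e x = none ∨ e (K * x + K) = none) ∧
  (∀ x < M, ∀ i < K, e (K * x + i + 1) = none ∨ ∃ y < M, e y = e (K * x + i + 1)) ∧
  (∀ x < M, e x = none ∨ ∃ y < N, e y = e 0 ∧ ∃ j < N, (parent K)^[j] y = x) ∧
  (∀ x < M, (e 0).getD n ≤ (e x).getD n) ∧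
  ∃ w < n, ∀ x < M, e x ≠ some w

theorem Flag.congr {K M N n : ℕ} {e e' : ℕ → Option ℕ} (hN : K * M < N) (hM : 0 < M) (hMN : M ≤ N)
    (h : ∀ t < N, e t = e' t) (hf : Flag K M N n e) : Flag K M N n e' := by
  have h0 := h 0 (hM.trans_le hMN)
  have hx : ∀ x < M, e x = e' x := fun x hx => h x (hx.trans_le hMN)
  have hc : ∀ x < M, ∀ i < K, K * x + i + 1 < N := fun x hx i hi => by
    have := Nat.mul_le_mul_left K (Nat.succ_le_of_lt hx)
    rw [Nat.mul_succ] at this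
    omega
  have hK : ∀ x < M, K * x + K < N := fun x hx => by
    have := Nat.mul_le_mul_left K (Nat.succ_le_of_lt hx)
    rw [Nat.mul_succ] at this
    omega
  obtain ⟨h1, h2, h3, h4, w, hw, h5⟩ := hf
  refine ⟨fun x hxM => ?_, fun x hxM i hi => ?_, fun x hxM => ?_, fun x hxM => ?_, w, hw,
    fun x hxM => ?_⟩
  · rw [← hx x hxM, ← h _ (hK x hxM)]; exact h1 x hxM
  · rw [← h _ (hc x hxM i hi)]
    refine (h2 x hxM i hi).imp_right ?_
    rintro ⟨y, hy, hye⟩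
    exact ⟨y, hy, (hx y hy) ▸ hye⟩
  · rw [← hx x hxM, ← h0]
    refine (h3 x hxM).imp_right ?_
    rintro ⟨y, hy, hye, hj⟩
    exact ⟨y, hy, (h y hy) ▸ hye, hj⟩
  · rw [← hx x hxM, ← h0]; exact h4 x hxM
  · rw [← hx x hxM]; exact h5 x hxM

theorem flag_congr {K M N n : ℕ} {e e' : ℕ → Option ℕ} (hN : K * M < N) (hM : 0 < M) (hMN : M ≤ N)
    (h : ∀ t < N, e t = e' t) : Flag K M N n e ↔ Flag K M N n e' :=
  ⟨Flag.congr hN hM hMN h, Flag.congr hN hM hMN fun t ht => (h t ht).symm⟩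

/-- The oracle answers for the lists `nb`. -/
def listAnswer {n : ℕ} (nb : Fin n → List (Fin n)) (v i : ℕ) : Option ℕ :=
  if hv : v < n then ((nb ⟨v, hv⟩)[i]?).map Fin.val else none

section Label

variable {n : ℕ} {nb : Fin n → List (Fin n)} {r : Fin n → Fin n → Prop} {K : ℕ}

theorem label_child (hK : 0 < K) (ans : ℕ → ℕ → Option ℕ) (v x i : ℕ) (hi : i < K) :
    label ans n K v (K * x + i + 1) = ans ((label ans n K v x).getD n) i := by
  rw [label, Nat.mul_add_div hK, Nat.div_eq_of_lt hi, Nat.mul_add_mod, Nat.mod_eq_of_lt hi,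
    Nat.add_zero]

theorem listAnswer_eq_some {v i b : ℕ} (h : listAnswer nb v i = some b) :
    ∃ (hv : v < n) (u : Fin n), u.val = b ∧ u ∈ nb ⟨v, hv⟩ := by
  unfold listAnswer at h
  split_ifs at h with hv
  obtain ⟨u, hu, rfl⟩ := Option.map_eq_some_iff.1 h
  exact ⟨hv, u, rfl, List.mem_of_getElem? hu⟩

/-- Tree edges are reversed arcs: a child is a predecessor of its parent. The root is its own parent
because of truncated subtraction, hence a path of length 0 or 1. -/
theorem label_parent (hnb : ∀ v u, u ∈ nb v ↔ r u v) {v : Fin n} {t : ℕ} {b : Fin n}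
    (h : label (listAnswer nb) n K v t = some b.val) :
    ∃ u : Fin n, label (listAnswer nb) n K v (parent K t) = some u.val ∧ ReflTransGen r b u := by
  cases t with
  | zero => exact ⟨b, by simpa [parent] using h, ReflTransGen.refl⟩
  | succ t =>
    rw [label] at h
    obtain ⟨hv, u, hub, hu⟩ := listAnswer_eq_some h
    obtain rfl := Fin.ext hub
    rcases hl : label (listAnswer nb) n K v (t / K) with _ | a
    · simp [hl] at hv
    · simp only [hl, Option.getD_some] at hv hu
      exact ⟨⟨a, hv⟩, by simp [parent, hl], ReflTransGen.single ((hnb _ _).1 hu)⟩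

theorem label_iterate_parent (hnb : ∀ v u, u ∈ nb v ↔ r u v) {v : Fin n} (j : ℕ) :
    ∀ {t : ℕ} {b : Fin n}, label (listAnswer nb) n K v t = some b.val →
    ∃ u : Fin n, label (listAnswer nb) n K v ((parent K)^[j] t) = some u.val ∧
      ReflTransGen r b u := by
  induction j with
  | zero => exact fun h => ⟨_, h, ReflTransGen.refl⟩
  | succ j ih =>
    intro t b h
    obtain ⟨u, hu, hbu⟩ := label_parent hnb h
    obtain ⟨w, hw, huw⟩ := ih hu
    exact ⟨w, hw, hbu.trans huw⟩

theorem label_lt {v : Fin n} {t b : ℕ} (h : label (listAnswer nb) n K v t = some b) : b < n := by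
  cases t with
  | zero => rw [label] at h; cases h; exact v.2
  | succ t =>
    rw [label] at h
    obtain ⟨_, u, rfl, _⟩ := listAnswer_eq_some h
    exact u.2

theorem label_reaches (hnb : ∀ v u, u ∈ nb v ↔ r u v) {v : Fin n} (t : ℕ) :
    ∀ b : Fin n, label (listAnswer nb) n K v t = some b.val → ReflTransGen r b v := by
  induction t using Nat.strong_induction_on with
  | _ t ih =>
    intro b h
    cases t with
    | zero =>
      rw [label] at h
      rw [Fin.ext (Option.some.inj h)]
    | succ t =>
      obtain ⟨u, hu, hbu⟩ := label_parent hnb h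
      refine hbu.trans (ih _ ?_ u hu)
      exact Nat.lt_succ_of_le (Nat.div_le_self _ _)

theorem exists_child (hK : 0 < K) (hnb : ∀ v u, u ∈ nb v ↔ r u v) {v : Fin n} {x : ℕ}
    {a b : Fin n} (hx : label (listAnswer nb) n K v x = some a.val)
    (hlen : (nb a).length ≤ K) (hba : r b a) :
    ∃ i < K, label (listAnswer nb) n K v (K * x + i + 1) = some b.val := by
  obtain ⟨i, hi, hib⟩ := List.mem_iff_getElem.1 ((hnb a b).2 hba)
  refine ⟨i, hi.trans_le hlen, ?_⟩
  rw [label_child hK _ _ _ _ (hi.trans_le hlen), hx]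
  simp [listAnswer, hi, hib]

/-- Closure under predecessors forces every ancestor of `v` to occur as a label. Climbing from a
later copy of `v` up to a node follows arcs forwards, so `v` reaches the label of that node. -/
theorem Flag.sound {M N : ℕ} (hK : 0 < K) (hM : 0 < M) (hnb : ∀ v u, u ∈ nb v ↔ r u v) {v : Fin n}
    (hf : Flag K M N n (label (listAnswer nb) n K v)) :
    IsSourceRep r v ∧ ∃ w, ¬ ReflTransGen r w v := by
  obtain ⟨h1, h2, h3, h4, w, hw, h5⟩ := hf
  have h0 : label (listAnswer nb) n K v 0 = some v.val := by rw [label]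
  have hclosed : ∀ u, ReflTransGen r u v →
      ∃ x < M, label (listAnswer nb) n K v x = some u.val := by
    intro u hu
    induction hu using ReflTransGen.head_induction_on with
    | refl => exact ⟨0, hM, h0⟩
    | @head b a hba _ ih =>
      obtain ⟨x, hx, hxa⟩ := ih
      -- An empty last child means that the list ends before position `K - 1`, so no predecessor is
      -- cut off.
      have hlen : (nb a).length ≤ K := by
        have hlast := (h1 x hx).resolve_left (by simp [hxa])
        have hKK : K * x + K = K * x + (K - 1) + 1 := by omega
        rw [hKK, label_child hK _ _ _ _ (by omega), hxa] at hlast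
        simp [listAnswer] at hlast
        omega
      obtain ⟨i, hi, hib⟩ := exists_child hK hnb hxa hlen hba
      obtain ⟨y, hy, hyb⟩ := (h2 x hx i hi).resolve_left (by simp [hib])
      exact ⟨y, hy, hyb.trans hib⟩
  refine ⟨⟨fun u hu => ?_, fun u hu => ?_⟩, ⟨w, hw⟩, fun hwv => ?_⟩
  · obtain ⟨x, hx, hxu⟩ := hclosed u hu
    obtain ⟨y, -, hy, j, -, hj⟩ := (h3 x hx).resolve_left (by simp [hxu])
    obtain ⟨u', hu', hvu'⟩ := label_iterate_parent hnb j (hy.trans h0)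
    rw [hj, hxu] at hu'
    rwa [Fin.ext (Option.some.inj hu')]
  · obtain ⟨x, hx, hxu⟩ := hclosed u hu
    have := h4 x hx
    rw [h0, hxu] at this
    exact this
  · obtain ⟨x, hx, hxw⟩ := hclosed _ hwv
    exact h5 x hx hxw

end Label

/-- `u` reaches `v` by a walk of length `j`. -/
def WalkOfLength {α : Type*} (r : α → α → Prop) : ℕ → α → α → Prop
  | 0, u, v => u = v
  | j + 1, u, v => ∃ w, r w v ∧ WalkOfLength r j u w

theorem WalkOfLength.head {α : Type*} {r : α → α → Prop} : ∀ {j : ℕ} {u v w : α}, r u v →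
    WalkOfLength r j v w → WalkOfLength r (j + 1) u w
  | 0, u, _, _, h, h' => ⟨u, h' ▸ h, rfl⟩
  | _ + 1, _, _, _, h, ⟨x, hx, hvx⟩ => ⟨x, hx, WalkOfLength.head h hvx⟩

theorem WalkOfLength.reflTransGen {α : Type*} {r : α → α → Prop} : ∀ {j : ℕ} {u v : α},
    WalkOfLength r j u v → ReflTransGen r u v
  | 0, _, _, h => h ▸ ReflTransGen.refl
  | _ + 1, _, _, ⟨_, hx, h⟩ => (WalkOfLength.reflTransGen h).tail hx

/-- The backward balls `D j` around `v` grow by at least one vertex per step until they contain all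
ancestors. -/
theorem exists_short_walk {α : Type*} [Finite α] {r : α → α → Prop} {u v : α} {k : ℕ}
    (hk : {x | ReflTransGen r x v}.ncard ≤ k) (h : ReflTransGen r u v) :
    ∃ j ≤ k, WalkOfLength r j u v := by
  set D : ℕ → Set α := fun j => {x | ∃ i ≤ j, WalkOfLength r i x v} with hD
  set R : Set α := {x | ReflTransGen r x v} with hR
  have hmono : ∀ j, D j ⊆ D (j + 1) := fun j x ⟨i, hi, hx⟩ => ⟨i, hi.trans j.le_succ, hx⟩
  have hDR : ∀ j, D j ⊆ R := fun j x ⟨i, _, hx⟩ => hx.reflTransGen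
  have hgrow : ∀ j, R ⊆ D j ∨ j + 1 ≤ (D j).ncard := by
    intro j
    induction j with
    | zero =>
      right
      have : v ∈ D 0 := ⟨0, le_rfl, rfl⟩
      exact (Set.ncard_pos (Set.toFinite _)).2 ⟨v, this⟩
    | succ j ih =>
      rcases ih with ih | ih
      · exact Or.inl (ih.trans (hmono j))
      by_cases heq : D (j + 1) ⊆ D j
      · left
        intro x hx
        refine hmono j ?_
        induction hx using ReflTransGen.head_induction_on with
        | refl => exact ⟨0, Nat.zero_le _, rfl⟩
        | head hab _ ih' =>
          obtain ⟨i, hi, hw⟩ := ih'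
          exact heq ⟨i + 1, by omega, hw.head hab⟩
      · right
        exact Nat.succ_le_of_lt (ih.trans_lt
          (Set.ncard_lt_ncard ⟨hmono j, heq⟩ (Set.toFinite _)))
  have : R ⊆ D k := (hgrow k).resolve_right fun hlt =>
    absurd ((hlt.trans (Set.ncard_le_ncard (hDR k) (Set.toFinite _))).trans hk) (by omega)
  exact this h

/-- A walk into `a` is traced backwards as a descent from any node labelled `a`. The last child of
`z` is `K * (z + 1)`, whence the iterated bound on the index. -/
theorem walk_node {n K : ℕ} {nb : Fin n → List (Fin n)} {r : Fin n → Fin n → Prop} (hK : 0 < K)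
    (hnb : ∀ v u, u ∈ nb v ↔ r u v) {v : Fin n} (hlen : ∀ a, ReflTransGen r a v →
      (nb a).length ≤ K) {x : ℕ} {a : Fin n} (hx : label (listAnswer nb) n K v x = some a.val) :
    ∀ (j : ℕ) (u : Fin n), WalkOfLength r j u a → ∃ y ≤ (fun z => K * (z + 1))^[j] x,
      label (listAnswer nb) n K v y = some u.val ∧ (parent K)^[j] y = x := by
  intro j
  induction j generalizing x a with
  | zero => rintro u rfl; exact ⟨x, le_rfl, hx, rfl⟩
  | succ j ih =>
    rintro u ⟨w, hwa, huw⟩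
    obtain ⟨i, hi, hib⟩ := exists_child hK hnb hx (hlen a (label_reaches hnb _ _ hx)) hwa
    obtain ⟨y, hy, hyu, hyp⟩ := ih hib u huw
    refine ⟨y, ?_, hyu, ?_⟩
    · rw [Function.iterate_succ_apply]
      have hmono : Monotone (fun z : ℕ => K * (z + 1)) := fun a b hab =>
        Nat.mul_le_mul_left K (Nat.succ_le_succ hab)
      refine hy.trans (hmono.iterate j ?_)
      change K * x + i + 1 ≤ K * (x + 1)
      rw [Nat.mul_succ]; omega
    · rw [Function.iterate_succ_apply', hyp, parent, Nat.add_sub_cancel, Nat.mul_add_div hK,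
        Nat.div_eq_of_lt hi, Nat.add_zero]

/-- Descending `k` levels from the root meets the whole component among the first `M` nodes; `k`
further levels below any of these meet `v` again among the first `N`. The arity `k + 1` leaves one
child position empty, as proof that the list is exhausted. -/
theorem Flag.complete {n k M N : ℕ} {nb : Fin n → List (Fin n)} {r : Fin n → Fin n → Prop}
    (hnb : ∀ v u, u ∈ nb v ↔ r u v) (hnodup : ∀ v, (nb v).Nodup)
    (hM : (fun z => (k + 1) * (z + 1))^[k] 0 < M)
    (hN : (fun z => (k + 1) * (z + 1))^[k] M < N) (hkN : k < N) {v : Fin n}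
    (hv : IsSourceRep r v) (hprop : ∃ w, ¬ ReflTransGen r w v)
    (hk : {u | ReflTransGen r u v}.ncard ≤ k) :
    Flag (k + 1) M N n (label (listAnswer nb) n (k + 1) v) := by
  have h0 : label (listAnswer nb) n (k + 1) v 0 = some v.val := by rw [label]
  -- Predecessors of an ancestor of `v` are again ancestors of `v`.
  have hlen : ∀ a, ReflTransGen r a v → (nb a).length ≤ k := by
    intro a ha
    rw [← List.toFinset_card_of_nodup (hnodup a), ← Set.ncard_coe_finset]
    refine (Set.ncard_le_ncard (fun u hu => ?_) (Set.toFinite _)).trans hk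
    exact ReflTransGen.head ((hnb a u).1 (by simpa using hu)) ha
  have hlen' : ∀ a, ReflTransGen r a v → (nb a).length ≤ k + 1 := fun a ha =>
    (hlen a ha).trans k.le_succ
  have hmono : Monotone (fun z : ℕ => (k + 1) * (z + 1)) := fun a b hab =>
    Nat.mul_le_mul_left _ (Nat.succ_le_succ hab)
  have hinfl : ∀ z : ℕ, z ≤ (k + 1) * (z + 1) := fun z => by nlinarith
  have hsteps : ∀ j ≤ k, ∀ z, (fun z => (k + 1) * (z + 1))^[j] z ≤
      (fun z => (k + 1) * (z + 1))^[k] z := fun j hj z =>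
    Function.monotone_iterate_of_id_le (f := fun z : ℕ => (k + 1) * (z + 1)) hinfl hj z
  have hlabel : ∀ x b, label (listAnswer nb) n (k + 1) v x = some b →
      ∃ u : Fin n, u.val = b ∧ ReflTransGen r u v := fun x b hb =>
    ⟨⟨b, label_lt hb⟩, rfl, label_reaches hnb x ⟨b, label_lt hb⟩ hb⟩
  have hnode : ∀ u, ReflTransGen r u v →
      ∃ y < M, label (listAnswer nb) n (k + 1) v y = some u.val := by
    intro u hu
    obtain ⟨j, hj, hw⟩ := exists_short_walk hk hu
    obtain ⟨y, hy, hyu, -⟩ := walk_node k.succ_pos hnb hlen' h0 j u hw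
    exact ⟨y, (hy.trans (hsteps j hj 0)).trans_lt hM, hyu⟩
  refine ⟨fun x _ => ?_, fun x _ i _ => ?_, fun x hxM => ?_, fun x _ => ?_, ?_⟩
  · rcases hx : label (listAnswer nb) n (k + 1) v x with _ | b
    · exact Or.inl rfl
    · right
      obtain ⟨u, rfl, hu⟩ := hlabel x b hx
      change label (listAnswer nb) n (k + 1) v ((k + 1) * x + k + 1) = none
      rw [label_child k.succ_pos _ _ _ _ k.lt_succ_self, hx]
      simpa [listAnswer] using hlen u hu
  · rcases hx : label (listAnswer nb) n (k + 1) v ((k + 1) * x + i + 1) with _ | b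
    · exact Or.inl rfl
    · obtain ⟨u, rfl, hu⟩ := hlabel _ b hx
      exact Or.inr (hnode u hu)
  · rcases hx : label (listAnswer nb) n (k + 1) v x with _ | b
    · exact Or.inl rfl
    · right
      obtain ⟨u, rfl, hu⟩ := hlabel x b hx
      have hk' : {w | ReflTransGen r w u}.ncard ≤ k :=
        (Set.ncard_le_ncard (fun w hw => ReflTransGen.trans hw hu) (Set.toFinite _)).trans hk
      obtain ⟨j, hj, hw⟩ := exists_short_walk hk' (hv.1 u hu)
      obtain ⟨y, hy, hyv, hyp⟩ := walk_node k.succ_pos hnb hlen' hx j v hw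
      exact ⟨y, ((hy.trans (hmono.iterate j hxM.le)).trans (hsteps j hj M)).trans_lt hN,
        hyv.trans h0.symm, j, hj.trans_lt hkN, hyp⟩
  · rw [h0]
    rcases hx : label (listAnswer nb) n (k + 1) v x with _ | b
    · exact v.2.le
    · obtain ⟨u, rfl, hu⟩ := hlabel x b hx
      exact hv.2 u hu
  · obtain ⟨w, hw⟩ := hprop
    exact ⟨w.val, w.2, fun x _ hx => hw (label_reaches hnb x w hx)⟩

end TolerantTesting

/-! ### The sampling algorithm and its computability -/

theorem PrimrecPred.forall_lt_of {α : Type*} [Primcodable α] {f : α → ℕ} {p : α → ℕ → Prop}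
    (hf : Primrec f) (hp : PrimrecPred fun z : α × ℕ => p z.1 z.2) :
    PrimrecPred fun a => ∀ x < f a, p a x := by
  have hR : PrimrecRel fun (x : ℕ) (a : α) => p a x :=
    hp.comp (Primrec.pair Primrec.snd Primrec.fst)
  exact (hR.forall_mem_list.comp (Primrec.list_range.comp hf) Primrec.id).of_eq (by simp)

theorem PrimrecPred.exists_lt_of {α : Type*} [Primcodable α] {f : α → ℕ} {p : α → ℕ → Prop}
    (hf : Primrec f) (hp : PrimrecPred fun z : α × ℕ => p z.1 z.2) :
    PrimrecPred fun a => ∃ x < f a, p a x := by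
  have hR : PrimrecRel fun (x : ℕ) (a : α) => p a x :=
    hp.comp (Primrec.pair Primrec.snd Primrec.fst)
  exact (hR.exists_mem_list.comp (Primrec.list_range.comp hf) Primrec.id).of_eq (by simp)

namespace TolerantTesting

theorem primrecPred_flag {α : Type*} [Primcodable α] (K M N : ℕ) {n : α → ℕ}
    {e : α → ℕ → Option ℕ} (hn : Primrec n) (he : Primrec₂ e) :
    PrimrecPred fun a => Flag K M N (n a) (e a) := by
  have hent : ∀ {β : Type _} [Primcodable β] {f : β → α} {g : β → ℕ}, Primrec f → Primrec g →
      Primrec fun b => e (f b) (g b) := fun hf hg => he.comp hf hg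
  have hKx : ∀ {β : Type _} [Primcodable β] {g : β → ℕ}, Primrec g →
      Primrec fun b => K * g b := fun hg => Primrec.nat_mul.comp (Primrec.const K) hg
  unfold Flag
  refine .and ?_ (.and ?_ (.and ?_ (.and ?_ ?_)))
  · refine .forall_lt_of (.const M) (.or ?_ ?_)
    · exact Primrec.eq.comp (hent .fst .snd) (.const none)
    · exact Primrec.eq.comp
        (hent .fst (Primrec.nat_add.comp (hKx .snd) (.const K))) (.const none)
  · refine .forall_lt_of (.const M) (.forall_lt_of (.const K) (.or ?_ ?_))
    · exact Primrec.eq.comp (hent (Primrec.fst.comp .fst) (Primrec.succ.comp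
        (Primrec.nat_add.comp (hKx (Primrec.snd.comp .fst)) .snd))) (.const none)
    · refine .exists_lt_of (.const M) (Primrec.eq.comp
        (hent (Primrec.fst.comp (Primrec.fst.comp .fst)) .snd) ?_)
      exact hent (Primrec.fst.comp (Primrec.fst.comp .fst)) (Primrec.succ.comp
        (Primrec.nat_add.comp (hKx (Primrec.snd.comp (Primrec.fst.comp .fst)))
          (Primrec.snd.comp .fst)))
  · refine .forall_lt_of (.const M) (.or ?_ (.exists_lt_of (.const N) (.and ?_
      (.exists_lt_of (.const N) ?_))))
    · exact Primrec.eq.comp (hent .fst .snd) (.const none)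
    · exact Primrec.eq.comp (hent (Primrec.fst.comp .fst) .snd)
        (hent (Primrec.fst.comp .fst) (.const 0))
    · refine Primrec.eq.comp (Primrec.nat_iterate .snd (Primrec.snd.comp .fst) ?_)
        (Primrec.snd.comp (Primrec.fst.comp .fst))
      exact Primrec.nat_div.comp
        (Primrec.nat_sub.comp Primrec.snd (.const 1)) (.const K)
  · refine .forall_lt_of (.const M) (Primrec.nat_le.comp ?_ ?_)
    · exact Primrec.option_getD.comp (hent .fst (.const 0)) (hn.comp .fst)
    · exact Primrec.option_getD.comp (hent .fst .snd) (hn.comp .fst)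
  · refine .exists_lt_of hn (.forall_lt_of (.const M) (.not (Primrec.eq.comp ?_ ?_)))
    · exact hent (Primrec.fst.comp .fst) .snd
    · exact Primrec.option_some.comp (Primrec.snd.comp .fst)

open Classical in
/-- The number of flagged blocks among the first `b` blocks of length `N` of a history. -/
noncomputable def flagCount (K M N n : ℕ) (h : History) (b : ℕ) : ℕ :=
  Nat.rec 0 (fun i a => a + if Flag K M N n fun t => h.getD (i * N + t) none then 1 else 0) b

open Classical in
/-- The sampling algorithm: `s` times it draws a vertex and queries the first `N` nodes of its
`K`-ary tree of in-neighbors, then `s` times the same with out-neighbors; it accepts if the number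
`a` of flagged trees satisfies `a * n * d ≤ p * s * m`. -/
noncomputable def samplingMove (K M N s p d n m : ℕ) (h : History) : Move :=
  if h.length < 2 * s * N then
    if h.length % N = 0 then .toss (n - 1)
    else if h.length < s * N then
      .ask (.inNbr ((h.getD (h.length / N * N + (h.length % N - 1) / K) none).getD n)
        ((h.length % N - 1) % K))
    else
      .ask (.outNbr ((h.getD (h.length / N * N + (h.length % N - 1) / K) none).getD n)
        ((h.length % N - 1) % K))
  else .halt (decide (flagCount K M N n h (2 * s) * n * d ≤ p * s * m))

theorem primrec_flagCount {α : Type*} [Primcodable α] (K M N b : ℕ) {n : α → ℕ} {h : α → History}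
    (hn : Primrec n) (hh : Primrec h) : Primrec fun a => flagCount K M N (n a) (h a) b := by
  classical
  have hflag : PrimrecPred fun x : α × ℕ × ℕ =>
      Flag K M N (n x.1) fun t => (h x.1).getD (x.2.1 * N + t) none := by
    refine primrecPred_flag K M N (hn.comp .fst) ?_
    exact (Primrec.list_getD none).comp (hh.comp (Primrec.fst.comp .fst)) (Primrec.nat_add.comp
      (Primrec.nat_mul.comp (Primrec.fst.comp (Primrec.snd.comp .fst)) (.const N)) .snd)
  have hstep : Primrec₂ fun (a : α) (z : ℕ × ℕ) => z.2 +
      if Flag K M N (n a) fun t => (h a).getD (z.1 * N + t) none then 1 else 0 :=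
    Primrec.nat_add.comp (Primrec.snd.comp .snd) (Primrec.ite hflag (.const 1) (.const 0))
  exact Primrec.nat_rec' (.const b) (.const 0) hstep

theorem primrec_query_inNbr : Primrec₂ Query.inNbr := by
  refine (Primrec.of_equiv_iff Query.equivSum).1 ?_
  exact Primrec.sumInr.comp (Primrec.sumInl.comp (Primrec.pair .fst .snd))

theorem primrec_query_outNbr : Primrec₂ Query.outNbr := by
  refine (Primrec.of_equiv_iff Query.equivSum).1 ?_
  exact Primrec.sumInr.comp (Primrec.sumInr.comp (Primrec.pair .fst .snd))

theorem primrec_move_halt : Primrec Move.halt :=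
  (Primrec.of_equiv_iff Move.equivSum).1
    (Primrec.sumInl : Primrec (Sum.inl : Bool → Bool ⊕ (ℕ ⊕ Query)))

theorem primrec_move_toss : Primrec Move.toss :=
  (Primrec.of_equiv_iff Move.equivSum).1 ((Primrec.sumInr :
    Primrec (Sum.inr : _ → Bool ⊕ (ℕ ⊕ Query))).comp
    (Primrec.sumInl : Primrec (Sum.inl : ℕ → ℕ ⊕ Query)))

theorem primrec_move_ask : Primrec Move.ask :=
  (Primrec.of_equiv_iff Move.equivSum).1 ((Primrec.sumInr :
    Primrec (Sum.inr : _ → Bool ⊕ (ℕ ⊕ Query))).comp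
    (Primrec.sumInr : Primrec (Sum.inr : Query → ℕ ⊕ Query)))

theorem primrec_samplingMove (K M N s p d : ℕ) :
    Primrec fun x : ℕ × ℕ × History => samplingMove K M N s p d x.1 x.2.1 x.2.2 := by
  classical
  have hn : Primrec fun x : ℕ × ℕ × History => x.1 := .fst
  have hm : Primrec fun x : ℕ × ℕ × History => x.2.1 := Primrec.fst.comp .snd
  have hh : Primrec fun x : ℕ × ℕ × History => x.2.2 := Primrec.snd.comp .snd
  have hl : Primrec fun x : ℕ × ℕ × History => x.2.2.length := Primrec.list_length.comp hh
  have hmod : Primrec fun x : ℕ × ℕ × History => x.2.2.length % N :=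
    Primrec.nat_mod.comp hl (.const N)
  have hpred : Primrec fun x : ℕ × ℕ × History => x.2.2.length % N - 1 :=
    Primrec.nat_sub.comp hmod (.const 1)
  have hi : Primrec fun x : ℕ × ℕ × History => (x.2.2.length % N - 1) % K :=
    Primrec.nat_mod.comp hpred (.const K)
  have hu : Primrec fun x : ℕ × ℕ × History => (x.2.2.getD
      (x.2.2.length / N * N + (x.2.2.length % N - 1) / K) none).getD x.1 :=
    Primrec.option_getD.comp ((Primrec.list_getD none).comp hh (Primrec.nat_add.comp
      (Primrec.nat_mul.comp (Primrec.nat_div.comp hl (.const N)) (.const N))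
      (Primrec.nat_div.comp hpred (.const K)))) hn
  unfold samplingMove
  refine Primrec.ite (Primrec.nat_lt.comp hl (.const _)) (Primrec.ite
    (Primrec.eq.comp hmod (.const 0)) ?_ (Primrec.ite (Primrec.nat_lt.comp hl (.const _)) ?_ ?_)) ?_
  · exact primrec_move_toss.comp (Primrec.nat_sub.comp hn (.const 1))
  · exact primrec_move_ask.comp (primrec_query_inNbr.comp hu hi)
  · exact primrec_move_ask.comp (primrec_query_outNbr.comp hu hi)
  · refine primrec_move_halt.comp (PrimrecPred.decide (Primrec.nat_le.comp ?_ ?_))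
    · exact Primrec.nat_mul.comp (Primrec.nat_mul.comp (primrec_flagCount K M N (2 * s) hn hh) hn)
        (.const d)
    · exact Primrec.nat_mul.comp (.const _) hm

/-- The sampling algorithm as a randomized algorithm. -/
noncomputable def samplingAlgorithm (K M N s p d : ℕ) : RandomizedAlgorithm where
  next := samplingMove K M N s p d
  computable := (primrec_samplingMove K M N s p d).to_comp

end TolerantTesting

/-! ### Runs of the algorithm and Chebyshev's inequality -/

namespace TolerantTesting

theorem haltsWithin_of_halts {A : History → Move} (O : Query → Option ℕ) {L : ℕ}
    (hA : ∀ h : History, L ≤ h.length → ∃ b, A h = .halt b) (t : ℕ) :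
    ∀ (q : ℕ) (h : History), t ≤ q → L ≤ h.length + t → HaltsWithin A O (t + 1) q h := by
  induction t with
  | zero =>
    intro q h _ hL
    obtain ⟨b, hb⟩ := hA h hL
    simp [HaltsWithin, hb]
  | succ t ih =>
    intro q h hq hL
    rw [HaltsWithin]
    split
    · trivial
    · exact fun r _ => ih q _ (by omega) (by simp; omega)
    · exact ⟨by omega, ih _ _ (by omega) (by simp; omega)⟩

/-- The neighbor queries made while the algorithm explores its `b`-th tree. -/
def blockAnswer (O : Query → Option ℕ) (s b v i : ℕ) : Option ℕ :=
  if b < s then O (.inNbr v i) else O (.outNbr v i)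

section Run

variable {K M N s p d n m : ℕ}

theorem samplingMove_toss {h : History} {b : ℕ} (hN : 0 < N) (hb : b < 2 * s)
    (hh : h.length = b * N) : samplingMove K M N s p d n m h = .toss (n - 1) := by
  have : b * N < 2 * s * N := Nat.mul_lt_mul_of_pos_right hb hN
  rw [samplingMove, if_pos (by rwa [hh]), if_pos (by simp [hh])]

/-- Entry `j` of a block of the history is the label of node `j`, entry 0 being the random root, so
the parent's label can be looked up in the block. A missing label becomes the non-vertex `n`. -/
theorem samplingMove_ask (O : Query → Option ℕ) (r : ℕ) {h : History} {b j : ℕ}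
    (hb : b < 2 * s) (hh : h.length = b * N) (hj : 0 < j) (hjN : j < N) :
    ∃ q, samplingMove K M N s p d n m
        (h ++ (List.range j).map (label (blockAnswer O s b) n K r)) = .ask q ∧
      O q = label (blockAnswer O s b) n K r j := by
  have hlen : (h ++ (List.range j).map (label (blockAnswer O s b) n K r)).length = N * b + j := by
    simp [hh, Nat.mul_comm]
  have hmod : (N * b + j) % N = j := by rw [Nat.mul_add_mod, Nat.mod_eq_of_lt hjN]
  have hdiv : (N * b + j) / N = b := by
    rw [Nat.mul_add_div (by omega), Nat.div_eq_of_lt hjN, Nat.add_zero]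
  have hlt : N * b + j < 2 * s * N := by
    have := Nat.mul_le_mul_right N (Nat.succ_le_of_lt hb)
    rw [Nat.succ_mul] at this
    have := Nat.mul_comm N b
    omega
  have hget : (h ++ (List.range j).map (label (blockAnswer O s b) n K r)).getD
      (b * N + (j - 1) / K) none = label (blockAnswer O s b) n K r ((j - 1) / K) := by
    have h1 : (j - 1) / K < j := (Nat.div_le_self _ _).trans_lt (by omega)
    rw [List.getD_append_right _ _ _ _ (hh ▸ Nat.le_add_right _ _), hh, Nat.add_sub_cancel_left]
    simp [List.getD, h1]
  have hiff : N * b + j < s * N ↔ b < s := by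
    constructor
    · intro hlt
      by_contra hsb
      have := Nat.mul_le_mul_right N (not_lt.1 hsb)
      have := Nat.mul_comm N b
      omega
    · intro hbs
      have := Nat.mul_le_mul_right N (Nat.succ_le_of_lt hbs)
      rw [Nat.succ_mul] at this
      have := Nat.mul_comm N b
      omega
  have hlab : label (blockAnswer O s b) n K r j = blockAnswer O s b
      ((label (blockAnswer O s b) n K r ((j - 1) / K)).getD n) ((j - 1) % K) := by
    obtain ⟨i, rfl⟩ : ∃ i, j = i + 1 := ⟨j - 1, by omega⟩
    rw [label]; rfl
  rw [samplingMove, hlen, hmod, hdiv, if_pos hlt, if_neg (by omega), hget, hlab]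
  by_cases hbs : b < s
  · rw [if_pos (hiff.2 hbs)]
    exact ⟨_, rfl, by rw [blockAnswer, if_pos hbs]⟩
  · rw [if_neg (mt hiff.1 hbs)]
    exact ⟨_, rfl, by rw [blockAnswer, if_neg hbs]⟩

theorem acceptProb_asks (O : Query → Option ℕ) (r : ℕ) {h : History} {b : ℕ}
    (hb : b < 2 * s) (hh : h.length = b * N) (T i : ℕ) (hi : i < N) :
    acceptProb (samplingMove K M N s p d n m) O (T + i)
        (h ++ (List.range (N - i)).map (label (blockAnswer O s b) n K r)) =
      acceptProb (samplingMove K M N s p d n m) O T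
        (h ++ (List.range N).map (label (blockAnswer O s b) n K r)) := by
  induction i with
  | zero => rfl
  | succ i ih =>
    obtain ⟨q, hq, hO⟩ := samplingMove_ask (K := K) (M := M) (p := p) (d := d) (n := n) (m := m)
      O r hb hh (j := N - (i + 1)) (by omega) (by omega)
    rw [← ih (by omega), ← Nat.add_assoc, acceptProb, hq]
    simp only [hO]
    rw [List.append_assoc, ← List.map_singleton, ← List.map_append, ← List.range_succ,
      Nat.succ_eq_add_one, show N - (i + 1) + 1 = N - i by omega]

theorem acceptProb_block (O : Query → Option ℕ) {h : History} {b : ℕ} (hn : 0 < n)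
    (hN : 0 < N) (hb : b < 2 * s) (hh : h.length = b * N) (T : ℕ) :
    acceptProb (samplingMove K M N s p d n m) O (T + N) h =
      (∑ r ∈ Finset.range n, acceptProb (samplingMove K M N s p d n m) O T
        (h ++ (List.range N).map (label (blockAnswer O s b) n K r))) / n := by
  have hTN : T + N = T + (N - 1) + 1 := by omega
  rw [hTN, acceptProb, samplingMove_toss hN hb hh]
  have hcast : ((n - 1 : ℕ) : ℝ) + 1 = n := by rw [← Nat.cast_succ]; congr 1; omega
  simp only [hcast]
  rw [show n - 1 + 1 = n by omega]
  congr 1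
  refine Finset.sum_congr rfl fun r _ => ?_
  rw [← acceptProb_asks O r hb hh T (N - 1) (by omega), show N - (N - 1) = 1 by omega]
  simp [label]

theorem flagCount_append {h l : History} (hN : K * M < N) (hM : 0 < M) (hMN : M ≤ N) (b : ℕ)
    (hh : b * N ≤ h.length) : flagCount K M N n (h ++ l) b = flagCount K M N n h b := by
  classical
  induction b with
  | zero => rfl
  | succ b ih =>
    rw [Nat.succ_mul] at hh
    have h1 := ih (by omega)
    unfold flagCount at h1 ⊢
    simp only [h1]
    congr 1
    refine if_congr (flag_congr hN hM hMN fun t ht => ?_) rfl rfl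
    exact List.getD_append _ _ _ _ (by omega)

open Classical in
/-- The indicator that the tree explored in the `b`-th block from the vertex `r` is flagged. -/
noncomputable def blockFlag (K M N s n : ℕ) (O : Query → Option ℕ) (b r : ℕ) : ℕ :=
  if Flag K M N n (label (blockAnswer O s b) n K r) then 1 else 0

theorem flagCount_block (O : Query → Option ℕ) (r : ℕ) {h : History} {b : ℕ} (hN : K * M < N)
    (hM : 0 < M) (hMN : M ≤ N) (hh : h.length = b * N) :
    flagCount K M N n (h ++ (List.range N).map (label (blockAnswer O s b) n K r)) (b + 1) =
      flagCount K M N n h b + blockFlag K M N s n O b r := by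
  classical
  have h1 := flagCount_append (n := n) (l := (List.range N).map (label (blockAnswer O s b) n K r))
    hN hM hMN b hh.ge
  unfold flagCount blockFlag at *
  simp only [h1]
  congr 1
  refine if_congr (flag_congr hN hM hMN fun t ht => ?_) rfl rfl
  rw [List.getD_append_right _ _ _ _ (by omega), hh, Nat.add_sub_cancel_left]
  simp [List.getD, ht]

/-- The probability that the tree explored in the `b`-th block is flagged. -/
noncomputable def blockMean (K M N s n : ℕ) (O : Query → Option ℕ) (b : ℕ) : ℝ :=
  (∑ r ∈ Finset.range n, (blockFlag K M N s n O b r : ℝ)) / n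

theorem blockFlag_le_one (O : Query → Option ℕ) (b r : ℕ) : blockFlag K M N s n O b r ≤ 1 := by
  unfold blockFlag; split_ifs <;> simp

/-- The cross term averages to zero, and a value in `[0, 1]` differs from the mean by at most 1. -/
theorem average_sq_le {n : ℕ} (hn : 0 < n) (y : ℕ → ℝ) (hy0 : ∀ r, 0 ≤ y r) (hy1 : ∀ r, y r ≤ 1)
    (D : ℝ) :
    (∑ r ∈ Finset.range n, (D + (y r - (∑ r ∈ Finset.range n, y r) / n)) ^ 2) ≤
      n * (D ^ 2 + 1) := by
  have hn' : (0 : ℝ) < n := Nat.cast_pos.2 hn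
  set μ : ℝ := (∑ r ∈ Finset.range n, y r) / n with hμ
  have hsum : ∑ r ∈ Finset.range n, y r = n * μ := by rw [hμ]; field_simp
  have hμ0 : 0 ≤ μ := div_nonneg (Finset.sum_nonneg fun r _ => hy0 r) hn'.le
  have hμ1 : μ ≤ 1 := by
    rw [hμ, div_le_one hn']
    exact (Finset.sum_le_sum fun r _ => hy1 r).trans (by simp)
  calc (∑ r ∈ Finset.range n, (D + (y r - μ)) ^ 2)
      ≤ ∑ r ∈ Finset.range n, (D ^ 2 + 1 + 2 * D * (y r - μ)) := by
        refine Finset.sum_le_sum fun r _ => ?_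
        have := hy0 r
        have := hy1 r
        have : (y r - μ) ^ 2 ≤ 1 := by
          rw [sq_le_one_iff_abs_le_one, abs_le]; constructor <;> linarith
        nlinarith
    _ = n * (D ^ 2 + 1) := by
        rw [Finset.sum_add_distrib, ← Finset.mul_sum, Finset.sum_sub_distrib, hsum]
        simp
        ring

/-- Chebyshev's inequality by backward induction over the blocks. Here `χ` is the correct verdict,
and a wrong one requires deviation at least `Δ`. Averaging over the root of one block adds at most 1
to the squared deviation, which pays for the drop of `j`. -/
theorem abs_acceptProb_sub_le (O : Query → Option ℕ) (hn : 0 < n) (hN : K * M < N) (hM : 0 < M)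
    (hMN : M ≤ N) {χ Δ : ℝ} (hΔ : 0 < Δ)
    (hχ : ∀ a : ℕ, (if a * n * d ≤ p * s * m then (1 : ℝ) else 0) = χ ∨
      Δ ^ 2 ≤ (a - ∑ i ∈ Finset.range (2 * s), blockMean K M N s n O i) ^ 2 ∧
        |(if a * n * d ≤ p * s * m then (1 : ℝ) else 0) - χ| ≤ 1) (j : ℕ) :
    ∀ (b : ℕ) (h : History), b + j = 2 * s → h.length = b * N →
      |acceptProb (samplingMove K M N s p d n m) O (j * N + 1) h - χ| ≤
        ((flagCount K M N n h b - ∑ i ∈ Finset.range b, blockMean K M N s n O i) ^ 2 + j) /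
          Δ ^ 2 := by
  have hn' : (0 : ℝ) < n := Nat.cast_pos.2 hn
  have hΔ' : 0 < Δ ^ 2 := by positivity
  induction j with
  | zero =>
    intro b h hb hh
    rw [Nat.add_zero] at hb
    subst hb
    rw [Nat.zero_mul, Nat.zero_add, acceptProb, samplingMove, if_neg (by omega)]
    simp only [decide_eq_true_eq, Nat.cast_zero, add_zero]
    rcases hχ (flagCount K M N n h (2 * s)) with heq | ⟨hge, habs⟩
    · rw [heq, sub_self, abs_zero]; positivity
    · exact habs.trans ((one_le_div hΔ').2 hge)
  | succ j ih =>
    intro b h hb hh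
    rw [show (j + 1) * N + 1 = j * N + 1 + N by ring,
      acceptProb_block O hn (by omega) (by omega) hh]
    set D : ℝ := flagCount K M N n h b - ∑ i ∈ Finset.range b, blockMean K M N s n O i with hD
    set f : ℕ → ℝ := fun r => acceptProb (samplingMove K M N s p d n m) O (j * N + 1)
      (h ++ (List.range N).map (label (blockAnswer O s b) n K r)) with hf
    have hstep : ∀ r, |f r - χ| ≤
        ((D + (blockFlag K M N s n O b r - blockMean K M N s n O b)) ^ 2 + j) / Δ ^ 2 := by
      intro r
      refine (ih (b + 1) _ (by omega) ?_).trans_eq ?_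
      · simp [hh, Nat.succ_mul]
      · rw [flagCount_block O r hN hM hMN hh, Finset.sum_range_succ, hD]
        push_cast
        ring
    have havg : (∑ r ∈ Finset.range n, f r) / n - χ = (∑ r ∈ Finset.range n, (f r - χ)) / n := by
      rw [Finset.sum_sub_distrib, Finset.sum_const, Finset.card_range, nsmul_eq_mul]
      field_simp
    rw [havg, abs_div, abs_of_pos hn', div_le_iff₀ hn']
    refine (Finset.abs_sum_le_sum_abs _ _).trans ((Finset.sum_le_sum fun r _ => hstep r).trans ?_)
    rw [← Finset.sum_div, Finset.sum_add_distrib, Finset.sum_const, Finset.card_range,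
      nsmul_eq_mul, div_mul_eq_mul_div]
    refine div_le_div_of_nonneg_right ?_ hΔ'.le
    have := average_sq_le hn (fun r => (blockFlag K M N s n O b r : ℝ)) (fun r => Nat.cast_nonneg _)
      (fun r => by exact_mod_cast blockFlag_le_one O b r) D
    unfold blockMean
    push_cast
    linarith

end Run

end TolerantTesting

/-! ### Choice of parameters and the tester -/

namespace TolerantTesting

theorem blockMean_eq {K M N s n : ℕ} {O : Query → Option ℕ} {b : ℕ} {ans : ℕ → ℕ → Option ℕ}
    (h : blockAnswer O s b = ans) :
    blockMean K M N s n O b = ({v : Fin n | Flag K M N n (label ans n K v)}.ncard : ℝ) / n := by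
  classical
  subst h
  rw [blockMean, Finset.sum_range, Set.ncard_eq_toFinset_card', ← Nat.cast_sum]
  congr 2
  unfold blockFlag
  rw [Finset.sum_boole, Nat.cast_id]
  congr 1
  ext
  simp

theorem sum_blockMean {K M N s n : ℕ} {O : Query → Option ℕ} {ans ans' : ℕ → ℕ → Option ℕ}
    (hin : ∀ v i, O (.inNbr v i) = ans v i) (hout : ∀ v i, O (.outNbr v i) = ans' v i) :
    ∑ b ∈ Finset.range (2 * s), blockMean K M N s n O b =
      s * ({v : Fin n | Flag K M N n (label ans n K v)}.ncard +
        {v : Fin n | Flag K M N n (label ans' n K v)}.ncard : ℝ) / n := by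
  rw [two_mul, Finset.sum_range_add,
    Finset.sum_congr rfl fun b hb => blockMean_eq (ans := ans) (by
      funext v i; rw [blockAnswer, if_pos (Finset.mem_range.1 hb), hin]),
    Finset.sum_congr rfl fun b _ => blockMean_eq (ans := ans') (by
      funext v i; rw [blockAnswer, if_neg (by omega), hout])]
  simp only [Finset.sum_const, Finset.card_range, nsmul_eq_mul]
  ring

theorem isSourceSample_flag {n k M N : ℕ} {nb : Fin n → List (Fin n)} {r : Fin n → Fin n → Prop}
    (hnb : ∀ v u, u ∈ nb v ↔ r u v) (hnodup : ∀ v, (nb v).Nodup)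
    (hM : (fun z => (k + 1) * (z + 1))^[k] 0 < M)
    (hN : (fun z => (k + 1) * (z + 1))^[k] M < N) (hkN : k < N) :
    IsSourceSample r k
      {v : Fin n | Flag (k + 1) M N n (label (listAnswer nb) n (k + 1) v)} where
  sound _ hv := Flag.sound k.succ_pos (Nat.zero_lt_of_lt hM) hnb hv
  complete _ hv hprop hk := Flag.complete hnb hnodup hM hN hkN hv hprop hk

theorem haltsWithin_samplingMove (K M N s p d n m : ℕ) (O : Query → Option ℕ) :
    HaltsWithin (samplingMove K M N s p d n m) O (2 * s * N + 1) (2 * s * N) [] := by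
  refine haltsWithin_of_halts O (L := 2 * s * N) (fun h hL => ?_) _ _ _ le_rfl (by simp)
  exact ⟨_, by rw [samplingMove, if_neg (by omega)]⟩

theorem abs_acceptProb_samplingMove_sub_le {K M N s p d n m : ℕ} (O : Query → Option ℕ)
    (hn : 0 < n) (hN : K * M < N) (hM : 0 < M) (hMN : M ≤ N) {χ Δ : ℝ} (hΔ : 0 < Δ)
    (hs : 6 * s ≤ Δ ^ 2)
    (hχ : ∀ a : ℕ, (if a * n * d ≤ p * s * m then (1 : ℝ) else 0) = χ ∨
      Δ ^ 2 ≤ (a - ∑ i ∈ Finset.range (2 * s), blockMean K M N s n O i) ^ 2 ∧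
        |(if a * n * d ≤ p * s * m then (1 : ℝ) else 0) - χ| ≤ 1) :
    |acceptProb (samplingMove K M N s p d n m) O (2 * s * N + 1) [] - χ| ≤ 1 / 3 := by
  refine (abs_acceptProb_sub_le O hn hN hM hMN hΔ hχ (2 * s) 0 [] (by omega) (by simp)).trans ?_
  rw [div_le_iff₀ (by positivity)]
  rw [show flagCount K M N n [] 0 = 0 from rfl, Finset.range_zero, Finset.sum_empty]
  push_cast
  linarith

/-- The threshold is `p / d`, with margin `δ` on both sides. The last condition makes the Chebyshev
bound `2 * s / Δ ^ 2` at most `1 / 3` for `Δ = s * δ * c`. -/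
theorem exists_sampling_parameters {β ε c : ℝ} (hβ : 0 < β) (hε : 0 < ε) (hc : 0 < c) :
    ∃ (k s p d : ℕ) (δ : ℝ), 4 ≤ β * k * c ∧ 0 < d ∧ 0 < s ∧ 0 < δ ∧
      (2 * ε + δ) * d ≤ p ∧ p + δ * d ≤ (4 * ε + β / 2) * d ∧ 6 * s ≤ (s * δ * c) ^ 2 := by
  obtain ⟨k, hk⟩ := exists_nat_ge (4 / (β * c))
  obtain ⟨q, hq1, hq2⟩ := exists_rat_btwn (show 2 * ε < 2 * ε + β / 4 by linarith)
  set δ : ℝ := min (q - 2 * ε) (β / 4) with hδ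
  have hδ0 : 0 < δ := lt_min (by linarith) (by linarith)
  have hδ1 : δ ≤ q - 2 * ε := min_le_left _ _
  have hδ2 : δ ≤ β / 4 := min_le_right _ _
  obtain ⟨s, hs⟩ := exists_nat_ge (6 / (δ * c) ^ 2)
  have hδc : 0 < (δ * c) ^ 2 := by positivity
  have hs0 : 0 < (s : ℝ) := (div_pos (by norm_num) hδc).trans_le hs
  have hqpos : (0 : ℝ) < q := by linarith
  have hd : (0 : ℝ) < q.den := Nat.cast_pos.2 q.den_pos
  have hnum : (q.num.toNat : ℝ) = q * q.den := by
    have h1 : ((q.num.toNat : ℤ) : ℝ) = q.num := by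
      rw [Int.toNat_of_nonneg (Rat.num_nonneg.2 (by exact_mod_cast hqpos.le))]
    have h2 : ((q * q.den : ℚ) : ℝ) = q.num := by rw [Rat.mul_den_eq_num]; simp
    push_cast at h1 h2
    rw [h2]
    exact h1
  refine ⟨k, s, q.num.toNat, q.den, δ, ?_, q.den_pos, Nat.cast_pos.1 hs0, hδ0, ?_, ?_, ?_⟩
  · rw [div_le_iff₀ (by positivity)] at hk; linarith
  · rw [hnum]; exact mul_le_mul_of_nonneg_right (by linarith) hd.le
  · rw [hnum, ← add_mul]; exact mul_le_mul_of_nonneg_right (by linarith) hd.le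
  · rw [div_le_iff₀ hδc] at hs
    calc 6 * (s : ℝ) ≤ (s * (δ * c) ^ 2) * s := mul_le_mul_of_nonneg_right hs hs0.le
      _ = (s * δ * c) ^ 2 := by ring

end TolerantTesting

theorem corollaryc (α β ε : ℝ) (hα : 0 < α) (hβ : 0 < β) (hε : 0 < ε) (c : ℝ) (hc : 0 < c) :
    ∃ T : TolerantTesting.RandomizedAlgorithm,
      TolerantTesting.IsTolerantTester c TolerantTesting.strongConnectivity
        ε ((4 + α) * ε + β) T := by
  open TolerantTesting in
  obtain ⟨k, s, p, d, δ, hk, hd, hs, hδ, hlow, hhigh, hΔ⟩ := exists_sampling_parameters hβ hε hc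
  -- `M` covers the first `k` levels; `N` covers `k` more levels below those nodes, all their
  -- children, and the iteration counts up to `k`.
  obtain ⟨M, hM⟩ : ∃ M, M = (fun z => (k + 1) * (z + 1))^[k] 0 + 1 := ⟨_, rfl⟩
  obtain ⟨N, hN⟩ : ∃ N, N = (fun z => (k + 1) * (z + 1))^[k] M + (k + 1) * M + k + M + 1 :=
    ⟨_, rfl⟩
  refine ⟨samplingAlgorithm (k + 1) M N s p d, fun _ => 2 * s * N,
    (isLittleO_const_id_atTop _).comp_tendsto tendsto_natCast_atTop_atTop, ?_⟩
  intro n m hn hcm G R _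
  have hdR : (0 : ℝ) < d := Nat.cast_pos.2 hd
  have hsR : (0 : ℝ) < s := Nat.cast_pos.2 hs
  have hnR : (0 : ℝ) < n := Nat.cast_pos.2 hn
  have hmR : (0 : ℝ) < m := (mul_pos hc hnR).trans_le hcm
  have hkR : (0 : ℝ) < k := by
    by_contra h0
    have : (k : ℝ) = 0 := le_antisymm (not_lt.1 h0) (Nat.cast_nonneg k)
    norm_num [this] at hk
  set F := {v : Fin n | Flag (k + 1) M N n (label (listAnswer R.inList) n (k + 1) v)} with hF
  set F' := {v : Fin n | Flag (k + 1) M N n (label (listAnswer R.outList) n (k + 1) v)} with hF'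
  have hsF : IsSourceSample G.Adj k F :=
    isSourceSample_flag R.mem_inList R.inList_nodup (by omega) (by omega) (by omega)
  have hsF' : IsSourceSample (Function.swap G.Adj) k F' :=
    isSourceSample_flag R.mem_outList R.outList_nodup (by omega) (by omega) (by omega)
  have hmean : ∑ b ∈ Finset.range (2 * s), blockMean (k + 1) M N s n R.answer b =
      s * (F.ncard + F'.ncard : ℝ) / n := sum_blockMean (fun _ _ => rfl) (fun _ _ => rfl)
  -- A margin of `δ * m` in the component count is a deviation of `s * δ * m / n`, at least `s * δ *
  -- c`, in the number of flags.
  have hdev : ∀ x : ℝ, s * δ * m ≤ |x| * n → (s * δ * c) ^ 2 ≤ x ^ 2 := by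
    intro x hx
    rw [← sq_abs x]
    refine pow_le_pow_left₀ (by positivity) (le_of_mul_le_mul_right ?_ hnR) 2
    calc s * δ * c * n = s * δ * (c * n) := by ring
      _ ≤ s * δ * m := by gcongr
      _ ≤ |x| * n := hx
  have hmul : ∀ a : ℕ, (a - s * (F.ncard + F'.ncard : ℝ) / n) * n =
      a * n - s * (F.ncard + F'.ncard) := fun a => by field_simp
  refine ⟨2 * s * N + 1, haltsWithin_samplingMove _ _ _ _ _ _ _ _ _, ?_, ?_⟩
  · rintro ⟨H, hH, hdist⟩
    rw [graphDist, div_le_iff₀ hmR] at hdist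
    have h1 : (F.ncard : ℝ) ≤ ε * m :=
      (Nat.cast_le.2 (hsF.ncard_le_of_stronglyConnected hH)).trans hdist
    have h2 : (F'.ncard : ℝ) ≤ ε * m :=
      (Nat.cast_le.2 (hsF'.ncard_swap_le_of_stronglyConnected hH)).trans hdist
    have := abs_acceptProb_samplingMove_sub_le (p := p) (d := d) (m := m) (χ := 1) R.answer hn
      (K := k + 1) (M := M) (N := N) (by omega) (by omega) (by omega) (by positivity) hΔ (by
        intro a
        split_ifs with ha
        · exact Or.inl rfl
        · refine Or.inr ⟨hdev _ ?_, by norm_num⟩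
          rw [hmean]
          refine le_trans ?_ (mul_le_mul_of_nonneg_right (le_abs_self _) hnR.le)
          rw [hmul]
          have ha' : (p : ℝ) * s * m < a * n * d := by exact_mod_cast not_le.1 ha
          refine le_of_mul_le_mul_right ?_ hdR
          have h3 := mul_le_mul_of_nonneg_right hlow (mul_pos hsR hmR).le
          have h4 := mul_le_mul_of_nonneg_left (add_le_add h1 h2) (mul_pos hsR hdR).le
          linarith)
    have := (abs_le.1 this).1
    change _ ≤ acceptProb (samplingMove _ _ _ _ _ _ _ _) _ _ _
    linarith
  · intro hfar
    obtain ⟨H, hH, hle⟩ := exists_stronglyConnected_near_of_sample hn hsF hsF'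
    have hfar' : ((4 + α) * ε + β) * m < (symmDiff (arcs G) (arcs H)).ncard := by
      by_contra hcon
      exact hfar ⟨H, hH, by rw [graphDist, div_le_iff₀ hmR]; exact not_lt.1 hcon⟩
    have hle' : ((symmDiff (arcs G) (arcs H)).ncard : ℝ) * k ≤
        (F.ncard + F'.ncard) * k + 2 * n := by exact_mod_cast hle
    have hnk : 2 * (n : ℝ) ≤ β / 2 * m * k := by
      have h3 := mul_le_mul_of_nonneg_left hcm (mul_pos hβ hkR).le
      have h4 := mul_le_mul_of_nonneg_right hk hnR.le
      linarith
    -- Half of `β` pays for the large components (`hnk`); the term `α * ε` is discarded.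
    have hX : (4 * ε + β / 2) * m ≤ F.ncard + F'.ncard := by
      refine le_of_mul_le_mul_right ?_ hkR
      have h3 := mul_le_mul_of_nonneg_right hfar'.le hkR.le
      have h4 : 0 ≤ α * ε * m * k := by positivity
      linarith
    have := abs_acceptProb_samplingMove_sub_le (p := p) (d := d) (m := m) (χ := 0) R.answer hn
      (K := k + 1) (M := M) (N := N) (by omega) (by omega) (by omega) (by positivity) hΔ (by
        intro a
        split_ifs with ha
        · refine Or.inr ⟨hdev _ ?_, by norm_num⟩
          rw [hmean]
          refine le_trans ?_ (mul_le_mul_of_nonneg_right (neg_le_abs _) hnR.le)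
          rw [neg_mul, hmul]
          have ha' : (a : ℝ) * n * d ≤ p * s * m := by exact_mod_cast ha
          refine le_of_mul_le_mul_right ?_ hdR
          have h3 := mul_le_mul_of_nonneg_right hhigh (mul_pos hsR hmR).le
          have h4 := mul_le_mul_of_nonneg_left hX (mul_pos hsR hdR).le
          linarith
        · exact Or.inl rfl)
    have := (abs_le.1 this).2
    change acceptProb (samplingMove _ _ _ _ _ _ _ _) _ _ _ ≤ _
    linarith
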